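/- Let $R$ be an associative ring with identity. We say that $R$ has finite (right) uniform dimension if, for some $n\ge 0$, there are uniform right ideals $I_1,\dots,I_n$ of $R$ whose sum is direct and is an essential right ideal of $R$ (a right ideal is uniform if it is nonzero and any two nonzero right ideals contained in it have nonzero intersection). A (unital) twisted partial action of $\mathbb{Z}$ on $R$ is a triple $\alpha=(\{D_i\}_{i\in\mathbb{Z}},\{\alpha_i\}_{i\in\mathbb{Z}},\{w_{i,j}\}_{i,j\in\mathbb{Z}})$, where each $D_i$ is a two-sided ideal of $R$ generated by a central idempotent $1_i$, each $\alpha_i:D_{-i}\to D_i$ is a ring isomorphism, and each $w_{i,j}$ is an invertible element of the ring $D_iD_{i+j}$ (with identity $1_i1_{i+j}$), such that for all $i,j,k\in\mathbb{Z}$: (i) $D_0=R$ and $\alpha_0=\mathrm{id}_R$; (ii) $\alpha_i(D_{-i}D_j)=D_iD_{i+j}$; (iii) $\alpha_i(\alpha_j(a))=w_{i,j}\,\alpha_{i+j}(a)\,w_{i,j}^{-1}$ for all $a\in D_{-j}D_{-j-i}$; (iv) $w_{i,0}=w_{0,i}=1_i$; (v) $\alpha_i(a\,w_{j,k})\,w_{i,j+k}=\alpha_i(a)\,w_{i,j}\,w_{i+j,k}$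 for all $a\in D_{-i}D_jD_{j+k}$. It is of finite type if there are $s_1,\dots,s_n\in\mathbb{Z}$ such that $\sum_{l=1}^n D_{j+s_l}=R$ for every $j\in\mathbb{Z}$. A twisted global action of $\mathbb{Z}$ on an associative, not necessarily unital ring $T$ consists of ring automorphisms $\beta_i$ of $T$ and invertible multipliers $u_{i,j}$ of $T$ ($i,j\in\mathbb{Z}$) such that, for all $i,j,k\in\mathbb{Z}$ and $t\in T$: $\beta_0=\mathrm{id}_T$; $\beta_i(\beta_j(t))=u_{i,j}\,\beta_{i+j}(t)\,u_{i,j}^{-1}$; $u_{i,0}=u_{0,i}=1$; and $\beta_i(t\,u_{j,k})\,u_{i,j+k}=\beta_i(t)\,u_{i,j}\,u_{i+j,k}$. (A multiplier $m$ of $T$ is a pair of additive maps $t\mapsto mt$, $t\mapsto tm$ of $T$ with $m(ab)=(ma)b$, $(ab)m=a(bm)$ and $(am)b=a(mb)$; multipliers compose by $(mn)t=m(nt)$, $t(mn)=(tm)n$.) It is an enveloping action (globalization) of $\alpha$ if there is an injective ring homomorphism $\varphi:R\to T$ such that, for all $i,j\in\mathbb{Z}$: $\varphi(R)$ is a two-sided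 ideal of $T$; $T=\sum_{i\in\mathbb{Z}}\beta_i(\varphi(R))$; $\varphi(D_i)=\varphi(R)\cap\beta_i(\varphi(R))$; $\varphi(\alpha_i(a))=\beta_i(\varphi(a))$ for all $a\in D_{-i}$; and $\varphi(a\,w_{i,j})=\varphi(a)\,u_{i,j}$, $\varphi(w_{i,j}\,a)=u_{i,j}\,\varphi(a)$ for all $a\in D_iD_{i+j}$. Theorem. Let $R$ be a ring with identity of finite uniform dimension and let $\alpha$ be a twisted partial action of $\mathbb{Z}$ on $R$. If $\alpha$ is of finite type, then $\alpha$ has an enveloping action. -/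

import Mathlib

universe u

/-! ### Right uniform (Goldie) dimension -/

/-- A module is uniform if it is nonzero and any two nonzero submodules meet nontrivially;
here for a submodule `U` of `M`. -/
def IsUniformSubmodule {A M : Type*} [Ring A] [AddCommGroup M] [Module A M]
    (U : Submodule A M) : Prop :=
  U ≠ ⊥ ∧ ∀ V W : Submodule A M, V ≤ U → W ≤ U → V ≠ ⊥ → W ≠ ⊥ → V ⊓ W ≠ ⊥

/-- A submodule is essential if it meets every nonzero submodule nontrivially. -/
def IsEssentialSubmodule {A M : Type*} [Ring A] [AddCommGroup M] [Module A M]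
    (N : Submodule A M) : Prop :=
  ∀ V : Submodule A M, V ≠ ⊥ → N ⊓ V ≠ ⊥

/-- `R` has right uniform dimension `n`: some direct sum of `n` uniform right ideals is an
essential right ideal. Right ideals are the `Rᵐᵒᵖ`-submodules of `R`. -/
def HasRightUniformDim (R : Type u) [Ring R] (n : ℕ) : Prop :=
  ∃ I : Fin n → Submodule Rᵐᵒᵖ R,
    (∀ k, IsUniformSubmodule (I k)) ∧ iSupIndep I ∧ IsEssentialSubmodule (⨆ k, I k)

/-- `R` has finite right uniform dimension. -/
def HasFiniteUniformDim (R : Type u) [Ring R] : Prop :=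
  ∃ n : ℕ, HasRightUniformDim R n

/-! ### Unital twisted partial actions of `ℤ` -/

/-- The product of two two-sided ideals: the ideal generated by the products `a * b`. -/
def idealProd {R : Type u} [Ring R] (I J : TwoSidedIdeal R) : TwoSidedIdeal R :=
  TwoSidedIdeal.span {x : R | ∃ a ∈ I, ∃ b ∈ J, x = a * b}

/-- A unital twisted partial action of the additive group `ℤ` on a unital ring `R`.
The element `e i` is the central idempotent written `1_i`; it is the identity of `D i`.
The element `winv i j` is the (unique) inverse of `w i j` in the ring `D i * D (i + j)`, whose
identity is `e i * e (i + j)`. -/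
structure TwistedPartialAction (R : Type u) [Ring R] where
  D : ℤ → TwoSidedIdeal R
  e : ℤ → R
  α : ∀ i : ℤ, D (-i) ≃+* D i
  w : ℤ → ℤ → R
  winv : ℤ → ℤ → R
  e_idem : ∀ i, e i * e i = e i
  e_central : ∀ i, ∀ r : R, e i * r = r * e i
  D_eq : ∀ i, D i = TwoSidedIdeal.span {e i}
  w_mem : ∀ i j, w i j ∈ idealProd (D i) (D (i + j))
  winv_mem : ∀ i j, winv i j ∈ idealProd (D i) (D (i + j))
  w_mul_winv : ∀ i j, w i j * winv i j = e i * e (i + j)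
  winv_mul_w : ∀ i j, winv i j * w i j = e i * e (i + j)
  D_zero : D 0 = ⊤
  α_zero : ∀ a : D (-0), (α 0 a : R) = a
  /-- `α_i (D_{-i} D_j) = D_i D_{i+j}`. -/
  α_image : ∀ i j,
    (fun a : D (-i) => (α i a : R)) '' {a | (a : R) ∈ idealProd (D (-i)) (D j)} =
      (idealProd (D i) (D (i + j)) : Set R)
  /-- `α_i (α_j a) = w_{i,j} α_{i+j}(a) w_{i,j}⁻¹` for `a ∈ D_{-j} D_{-j-i}`.
  The membership proofs `hj`, `hij`, `hi` only make the three values of `α` typecheck: they all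
  follow from the first hypothesis on `a` (`hi` with the help of `α_image`). -/
  α_comp : ∀ i j, ∀ a : R, a ∈ idealProd (D (-j)) (D (-j - i)) →
    ∀ (hj : a ∈ D (-j)) (hij : a ∈ D (-(i + j))) (hi : (α j ⟨a, hj⟩ : R) ∈ D (-i)),
      (α i ⟨(α j ⟨a, hj⟩ : R), hi⟩ : R) = w i j * (α (i + j) ⟨a, hij⟩ : R) * winv i j
  w_zero_right : ∀ i, w i 0 = e i
  w_zero_left : ∀ i, w 0 i = e i
  /-- `α_i (a w_{j,k}) w_{i,j+k} = α_i(a) w_{i,j} w_{i+j,k}` for `a ∈ D_{-i} D_j D_{j+k}`. -/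
  cocycle : ∀ i j k, ∀ a : R, a ∈ idealProd (idealProd (D (-i)) (D j)) (D (j + k)) →
    ∀ ha : a ∈ D (-i),
      (α i ⟨a * w j k, (D (-i)).mul_mem_right a (w j k) ha⟩ : R) * w i (j + k) =
        (α i ⟨a, ha⟩ : R) * w i j * w (i + j) k

/-- Finite type: for some finite set `s` of integers, `∑_{k ∈ s} D_{j+k} = R` for every `j`.
(The supremum of two-sided ideals is their sum.) -/
def TwistedPartialAction.IsOfFiniteType {R : Type u} [Ring R]
    (α : TwistedPartialAction R) : Prop :=
  ∃ s : Finset ℤ, ∀ j : ℤ, (⨆ k ∈ s, α.D (j + k)) = ⊤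

/-! ### Multipliers of a not necessarily unital ring -/

/-- A multiplier `m` of a ring `T`: `lmul t` is `m t`, and `rmul t` is `t m`. -/
@[ext]
structure RingMultiplier (T : Type u) [NonUnitalRing T] where
  lmul : T →+ T
  rmul : T →+ T
  lmul_mul : ∀ a b : T, lmul (a * b) = lmul a * b
  mul_rmul : ∀ a b : T, rmul (a * b) = a * rmul b
  rmul_mul : ∀ a b : T, rmul a * b = a * lmul b

namespace RingMultiplier

variable {T : Type u} [NonUnitalRing T]

/-- `(m n) t = m (n t)`, `t (m n) = (t m) n`. -/
instance : Mul (RingMultiplier T) where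
  mul m n :=
    { lmul := m.lmul.comp n.lmul
      rmul := n.rmul.comp m.rmul
      lmul_mul := fun a b => by simp [m.lmul_mul, n.lmul_mul]
      mul_rmul := fun a b => by simp [m.mul_rmul, n.mul_rmul]
      rmul_mul := fun a b => by simp [m.rmul_mul, n.rmul_mul] }

instance : One (RingMultiplier T) where
  one :=
    { lmul := AddMonoidHom.id T
      rmul := AddMonoidHom.id T
      lmul_mul := fun _ _ => rfl
      mul_rmul := fun _ _ => rfl
      rmul_mul := fun _ _ => rfl }

instance : Monoid (RingMultiplier T) where
  mul_assoc _ _ _ := rfl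
  one_mul _ := rfl
  mul_one _ := rfl

end RingMultiplier

/-! ### Twisted global actions and enveloping actions -/

/-- A twisted global action of `ℤ` on a not necessarily unital ring `T`; the twisting is by
invertible multipliers of `T`. -/
structure TwistedGlobalAction (T : Type u) [NonUnitalRing T] where
  β : ℤ → T ≃+* T
  u : ℤ → ℤ → (RingMultiplier T)ˣ
  β_zero : ∀ t, β 0 t = t
  /-- `β_i (β_j t) = u_{i,j} β_{i+j}(t) u_{i,j}⁻¹`. -/
  β_comp : ∀ i j, ∀ t : T,
    β i (β j t) = (↑(u i j)⁻¹ : RingMultiplier T).rmul ((u i j).val.lmul (β (i + j) t))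
  u_zero_right : ∀ i, u i 0 = 1
  u_zero_left : ∀ i, u 0 i = 1
  /-- `β_i (t u_{j,k}) u_{i,j+k} = β_i(t) u_{i,j} u_{i+j,k}`. -/
  cocycle : ∀ i j k, ∀ t : T,
    (u i (j + k)).val.rmul (β i ((u j k).val.rmul t)) =
      (u (i + j) k).val.rmul ((u i j).val.rmul (β i t))

/-- The twisted global action `β` on `T` is an enveloping action of `α`, via `φ : R → T`. -/
structure IsEnvelopingVia {R : Type u} [Ring R] (α : TwistedPartialAction R)
    {T : Type u} [NonUnitalRing T] (β : TwistedGlobalAction T) (φ : R →ₙ+* T) : Prop where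
  injective : Function.Injective φ
  /-- `φ(R)` is an ideal of `T`. -/
  mul_mem_left : ∀ (t : T) (r : R), t * φ r ∈ Set.range φ
  mul_mem_right : ∀ (t : T) (r : R), φ r * t ∈ Set.range φ
  /-- `T = ∑_i β_i(φ(R))`. -/
  sum_eq_top : AddSubgroup.closure (⋃ i : ℤ, β.β i '' Set.range φ) = ⊤
  /-- `φ(D_i) = φ(R) ∩ β_i(φ(R))`. -/
  map_D : ∀ i, φ '' (α.D i : Set R) = Set.range φ ∩ β.β i '' Set.range φ
  map_α : ∀ i, ∀ a : α.D (-i), φ (α.α i a : R) = β.β i (φ a)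
  /-- `φ(a w_{i,j}) = φ(a) u_{i,j}` and `φ(w_{i,j} a) = u_{i,j} φ(a)` for `a ∈ D_i D_{i+j}`. -/
  map_mul_w : ∀ i j, ∀ a ∈ idealProd (α.D i) (α.D (i + j)),
    φ (a * α.w i j) = (β.u i j).val.rmul (φ a)
  map_w_mul : ∀ i j, ∀ a ∈ idealProd (α.D i) (α.D (i + j)),
    φ (α.w i j * a) = (β.u i j).val.lmul (φ a)

/-- `α` has an enveloping action (a globalization). -/
def TwistedPartialAction.HasEnvelopingAction {R : Type u} [Ring R]
    (α : TwistedPartialAction R) : Prop :=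
  ∃ (T : Type u) (_ : NonUnitalRing T) (β : TwistedGlobalAction T) (φ : R →ₙ+* T),
    IsEnvelopingVia α β φ

/-! The obstacle to globalizing is that `w g h` is invertible only in `D g * D (g + h)`. If it
extends to units `W g h` of `R` satisfying `α_m(W g h) W m (g+h) = 1_m W m g W (m+g) h`, an
enveloping action can be built inside the functions `ℤ → R`.

Finite type provides the extension. Around each `g` the ideals `D (g + s_l)` cover `R`, so making
their idempotents disjoint splits `1` into orthogonal central pieces `part g k`, with `part g k` in
`D (g + s_k)`. On `part g j * part (g+h) k`, let `W g h` be `w (g+s_j) (h+s_k-s_j)`, which is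
invertible there. The same shifts serve every `g`, so `α_m` carries pieces to pieces (`act_part`),
and on each piece the identity for `W` is the cocycle identity for `w` (`act_unit_mul`). Taking `s_0
= 0` makes `W` restrict to `w`.

Embed `R` by `a ↦ (n ↦ α_n(1_{-n} a))`, and let `g` act by translation followed by conjugation by `n
↦ W n g`. The twist `n ↦ W n g W (n+g) h (W n (g+h))⁻¹` is formally a coboundary, so the axioms of a
global action hold for all functions. The identity for `W` shows that the twist multiplies each
translate of `R` into itself (`actsTo_localTwist`), so the sum of the translates is an invariant
ring. -/

/-! ### Ideals generated by central idempotents. -/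

theorem TwoSidedIdeal.mem_span_singleton_idem {R : Type u} [Ring R] {e : R} (he : e * e = e)
    (hc : ∀ r, e * r = r * e) {x : R} : x ∈ TwoSidedIdeal.span {e} ↔ e * x = x := by
  constructor
  · intro hx
    rw [TwoSidedIdeal.mem_span_iff] at hx
    have := hx (TwoSidedIdeal.mk' {x | e * x = x} (by simp)
      (fun {x y} hx hy => (mul_add e x y).trans (congrArg₂ (· + ·) hx hy)) (fun {x} hx => by simp_all)
      (fun {x y} hy => by
        simp only [Set.mem_ofPred_eq] at *
        rw [← mul_assoc, hc, mul_assoc, hy])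
      (fun {x y} hx => by
        simp only [Set.mem_ofPred_eq] at *
        rw [← mul_assoc, hx])) (by simpa using he)
    simpa using this
  · intro hx
    rw [← hx]
    exact TwoSidedIdeal.mul_mem_right _ _ _ (TwoSidedIdeal.subset_span rfl)

theorem mem_idealProd_iff {R : Type u} [Ring R] {I J : TwoSidedIdeal R} {e f : R}
    (he : e * e = e) (hf : f * f = f) (hec : ∀ r, e * r = r * e) (hfc : ∀ r, f * r = r * f)
    (hI : ∀ x, x ∈ I ↔ e * x = x) (hJ : ∀ x, x ∈ J ↔ f * x = x) {x : R} :
    x ∈ idealProd I J ↔ e * f * x = x := by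
  have key : idealProd I J = TwoSidedIdeal.span {e * f} := by
    apply le_antisymm
    · refine TwoSidedIdeal.span_le.2 ?_
      rintro _ ⟨a, ha, b, hb, rfl⟩
      have : a * b = e * f * (a * b) := by
        conv_lhs => rw [← (hI a).1 ha, ← (hJ b).1 hb]
        rw [mul_assoc, ← mul_assoc a f b, ← hfc a]
        simp only [mul_assoc]
      rw [this]
      exact TwoSidedIdeal.mul_mem_right _ _ _ (TwoSidedIdeal.subset_span rfl)
    · refine TwoSidedIdeal.span_le.2 ?_
      rintro _ rfl
      exact TwoSidedIdeal.subset_span ⟨e, (hI e).2 he, f, (hJ f).2 hf, rfl⟩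
  rw [key, TwoSidedIdeal.mem_span_singleton_idem]
  · rw [mul_assoc, ← mul_assoc f e f, ← hec f, mul_assoc, hf, ← mul_assoc, he]
  · intro r
    rw [mul_assoc, hfc, ← mul_assoc, hec, mul_assoc]

/-! ### The partial action as everywhere defined endomorphisms of `R`. -/

namespace TwistedPartialAction

variable {R : Type u} [Ring R] (α : TwistedPartialAction R)

theorem e_comm (i j : ℤ) : α.e i * α.e j = α.e j * α.e i := α.e_central i _

theorem mem_D {i : ℤ} {x : R} : x ∈ α.D i ↔ α.e i * x = x := by
  rw [α.D_eq, TwoSidedIdeal.mem_span_singleton_idem (α.e_idem i) (α.e_central i)]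

theorem e_zero : α.e 0 = 1 := by
  have : (1 : R) ∈ α.D 0 := by rw [α.D_zero]; trivial
  simpa using α.mem_D.1 this

theorem mem_prod {i j : ℤ} {x : R} :
    x ∈ idealProd (α.D i) (α.D j) ↔ α.e i * α.e j * x = x :=
  mem_idealProd_iff (α.e_idem i) (α.e_idem j) (α.e_central i) (α.e_central j)
    (fun _ => α.mem_D) (fun _ => α.mem_D)

theorem e_mul_idem (i j : ℤ) : α.e i * α.e j * (α.e i * α.e j) = α.e i * α.e j := by
  rw [mul_assoc, ← mul_assoc (α.e j), α.e_comm j i, mul_assoc, α.e_idem, ← mul_assoc, α.e_idem]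

theorem e_mul_central (i j : ℤ) (r : R) : α.e i * α.e j * r = r * (α.e i * α.e j) := by
  rw [mul_assoc, α.e_central j, ← mul_assoc, α.e_central i, mul_assoc]

theorem mem_prod_prod {i j k : ℤ} {x : R} :
    x ∈ idealProd (idealProd (α.D i) (α.D j)) (α.D k) ↔ α.e i * α.e j * α.e k * x = x :=
  mem_idealProd_iff (α.e_mul_idem i j) (α.e_idem k) (α.e_mul_central i j) (α.e_central k)
    (fun _ => α.mem_prod) (fun _ => α.mem_D)

/-- The restriction of an element of `R` to the domain of `α i`. -/
def restrict (i : ℤ) : R →ₙ+* α.D (-i) where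
  toFun a := ⟨α.e (-i) * a, α.mem_D.2 (by rw [← mul_assoc, α.e_idem])⟩
  map_mul' a b := Subtype.ext (by
    change α.e (-i) * (a * b) = α.e (-i) * a * (α.e (-i) * b)
    rw [mul_assoc, ← mul_assoc a, ← α.e_central _ a, ← mul_assoc, ← mul_assoc, ← mul_assoc,
      α.e_idem])
  map_zero' := Subtype.ext (mul_zero _)
  map_add' a b := Subtype.ext (mul_add _ _ _)

/-- The extension of `α i` to a non-unital endomorphism of `R`: `a ↦ α i (1_{-i} a)`. -/
def act (i : ℤ) : R →ₙ+* R where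
  toFun a := (α.α i (α.restrict i a) : R)
  map_mul' a b := by rw [map_mul, map_mul]; rfl
  map_zero' := by rw [map_zero, map_zero]; rfl
  map_add' a b := by rw [map_add, map_add]; rfl

theorem act_of_mem {i : ℤ} {a : R} (ha : a ∈ α.D (-i)) : (α.α i ⟨a, ha⟩ : R) = α.act i a := by
  have : α.restrict i a = ⟨a, ha⟩ := Subtype.ext (α.mem_D.1 ha)
  change _ = (α.α i (α.restrict i a) : R)
  rw [this]

theorem act_mem (i : ℤ) (a : R) : α.act i a ∈ α.D i := (α.α i (α.restrict i a)).2

theorem e_mul_act (i : ℤ) (a : R) : α.e i * α.act i a = α.act i a := α.mem_D.1 (α.act_mem i a)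

theorem act_e_neg_mul (i : ℤ) (a : R) : α.act i (α.e (-i) * a) = α.act i a := by
  have h : α.e (-i) * a ∈ α.D (-i) := α.mem_D.2 (by rw [← mul_assoc, α.e_idem])
  rw [← α.act_of_mem h]; rfl

/-- `α_i` maps `D (-i) * D j` onto `D i * D (i + j)`, so it matches their identity elements. -/
theorem act_e (i j : ℤ) : α.act i (α.e j) = α.e i * α.e (i + j) := by
  have h1 : α.e i * α.e (i + j) ∈ (idealProd (α.D i) (α.D (i + j)) : Set R) :=
    α.mem_prod.2 (α.e_mul_idem _ _)
  have h2 : α.act i (α.e j) ∈ (idealProd (α.D i) (α.D (i + j)) : Set R) := by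
    rw [← α.α_image i j]
    exact ⟨α.restrict i (α.e j), α.mem_prod.2 (α.e_mul_idem _ _), rfl⟩
  rw [← α.α_image i j] at h1
  obtain ⟨b, hb, hb'⟩ := h1
  have hb' : (α.α i b : R) = α.e i * α.e (i + j) := hb'
  have hb : (b : R) ∈ idealProd (α.D (-i)) (α.D j) := hb
  rw [α.act_of_mem b.2] at hb'
  have h3 := α.mem_prod.1 h2
  rw [← hb', ← map_mul, ← α.act_e_neg_mul, ← α.e_central j, ← mul_assoc, α.mem_prod.1 hb] at h3
  rw [← h3, hb']

theorem act_one (i : ℤ) : α.act i 1 = α.e i := by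
  rw [← α.e_zero, α.act_e, add_zero, α.e_idem]

theorem act_zero (a : R) : α.act 0 a = a := by
  have h : a ∈ α.D (-0) := α.mem_D.2 (by rw [neg_zero, α.e_zero, one_mul])
  rw [← α.act_of_mem h, α.α_zero]

theorem e_mul_w (i j : ℤ) : α.e i * α.e (i + j) * α.w i j = α.w i j := α.mem_prod.1 (α.w_mem i j)

theorem e_mul_winv (i j : ℤ) : α.e i * α.e (i + j) * α.winv i j = α.winv i j :=
  α.mem_prod.1 (α.winv_mem i j)

theorem act_act (i j : ℤ) (a : R) :
    α.act i (α.act j a) = α.w i j * α.act (i + j) a * α.winv i j := by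
  -- The axiom covers only `D (-j) * D (-j - i)`; the idempotents introduced by cutting `a` down to
  -- it are absorbed by the outer `act i` and by `w i j`.
  set b := α.e (-j) * α.e (-j - i) * a with hb
  have hbm : b ∈ idealProd (α.D (-j)) (α.D (-j - i)) :=
    α.mem_prod.2 (by rw [hb, ← mul_assoc, α.e_mul_idem])
  have hj : b ∈ α.D (-j) := α.mem_D.2 (by rw [hb, ← mul_assoc, ← mul_assoc, α.e_idem])
  have hij : b ∈ α.D (-(i + j)) := α.mem_D.2 (by
    rw [hb, show -(i + j) = -j - i by ring, ← mul_assoc, ← mul_assoc, α.e_comm (-j - i),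
      mul_assoc (α.e (-j)), α.e_idem])
  have hjb : α.act j b = α.e (-i) * α.act j a := by
    rw [hb, mul_assoc, α.act_e_neg_mul, map_mul, α.act_e, α.e_comm, mul_assoc, α.e_mul_act]
    congr 2; ring
  have hijb : α.act (i + j) b = α.e i * α.act (i + j) a := by
    rw [hb, α.e_comm, mul_assoc, show -j - i = -(i + j) by ring, α.act_e_neg_mul, map_mul,
      α.act_e, α.e_comm, mul_assoc, α.e_mul_act]
    congr 2; ring
  have hi : (α.α j ⟨b, hj⟩ : R) ∈ α.D (-i) := by
    rw [α.act_of_mem, hjb]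
    exact α.mem_D.2 (by rw [← mul_assoc, α.e_idem])
  have := α.α_comp i j b hbm hj hij hi
  rw [α.act_of_mem, α.act_of_mem, α.act_of_mem, hjb, hijb, α.act_e_neg_mul] at this
  rw [this, ← mul_assoc, ← α.e_central i]
  conv_lhs => rw [← α.e_mul_w, ← mul_assoc, ← mul_assoc, α.e_idem, α.e_mul_w]

theorem act_w (i j k : ℤ) :
    α.act i (α.w j k) * α.w i (j + k) = α.w i j * α.w (i + j) k := by
  -- The cocycle axiom at the identity of `D (-i) * D j * D (j + k)` contains all its other
  -- instances.
  set b := α.e (-i) * α.e j * α.e (j + k) with hb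
  have hbb : b * b = b := by
    rw [hb]
    rw [mul_assoc, ← mul_assoc (α.e (j + k)), α.e_central (j + k), mul_assoc (α.e (-i) * α.e j),
      α.e_idem, ← mul_assoc, α.e_mul_idem]
  have hbm : b ∈ idealProd (idealProd (α.D (-i)) (α.D j)) (α.D (j + k)) :=
    α.mem_prod_prod.2 hbb
  have hbi : b ∈ α.D (-i) := α.mem_D.2 (by rw [hb, ← mul_assoc, ← mul_assoc, α.e_idem])
  have := α.cocycle i j k b hbm hbi
  rw [α.act_of_mem, α.act_of_mem] at this
  have h1 : α.act i (b * α.w j k) = α.act i (α.w j k) := by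
    rw [hb, mul_assoc (α.e (-i)), mul_assoc, α.e_mul_w, α.act_e_neg_mul]
  have h2 : α.act i b = α.e i * α.e (i + j) * α.e (i + j + k) := by
    rw [hb, mul_assoc, α.act_e_neg_mul, map_mul, α.act_e, α.act_e, ← mul_assoc,
      ← α.e_central i (α.e i * _), ← mul_assoc, α.e_idem, add_assoc]
  rw [h1, h2] at this
  rw [this, mul_assoc (α.e i * α.e (i + j)), α.e_central (i + j + k), ← mul_assoc, α.e_mul_w,
    mul_assoc]
  conv_rhs => rw [← α.e_mul_w (i + j) k]
  conv_lhs => rw [← α.e_mul_w (i + j) k]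
  rw [← mul_assoc (α.e (i + j + k)), ← mul_assoc (α.e (i + j + k)), α.e_comm _ (i + j),
    mul_assoc (α.e (i + j)), α.e_idem]

end TwistedPartialAction

/-! ### Central partitions of unity and gluing. -/

theorem central_mul_congr {R : Type u} [Ring R] {z x x' y y' : R} (hz : ∀ r, z * r = r * z)
    (hx : z * x = z * x') (hy : z * y = z * y') : z * (x * y) = z * (x' * y') := by
  rw [← mul_assoc, hx, hz, mul_assoc, hy, ← mul_assoc, ← hz, mul_assoc]

theorem central_mul {R : Type u} [Ring R] {z z' : R} (hz : ∀ r, z * r = r * z)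
    (hz' : ∀ r, z' * r = r * z') (r : R) : z * z' * r = r * (z * z') := by
  rw [mul_assoc, hz', ← mul_assoc, hz, mul_assoc]

/-- The elements `p 0, …, p (N - 1)` are orthogonal, central, and sum to `1`. -/
structure IsCentralPartition {R : Type u} [Ring R] (N : ℕ) (p : ℕ → R) : Prop where
  central : ∀ k r, p k * r = r * p k
  orth : ∀ j k, j ≠ k → p j * p k = 0
  sum_eq_one : ∑ k ∈ Finset.range N, p k = 1

namespace IsCentralPartition

variable {R : Type u} [Ring R] {N : ℕ} {p q : ℕ → R}

theorem idem (hp : IsCentralPartition N p) {k : ℕ} (hk : k < N) : p k * p k = p k := by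
  have h := congrArg (p k * ·) hp.sum_eq_one
  simp only [Finset.mul_sum, mul_one] at h
  rw [Finset.sum_eq_single k (fun j _ hj => hp.orth k j hj.symm)
    (fun h => absurd (Finset.mem_range.2 hk) h)] at h
  exact h

theorem eq_of_forall_mul_eq (hp : IsCentralPartition N p) {x y : R}
    (h : ∀ k < N, p k * x = p k * y) : x = y := by
  rw [← one_mul x, ← one_mul y, ← hp.sum_eq_one, Finset.sum_mul, Finset.sum_mul]
  exact Finset.sum_congr rfl fun k hk => h k (Finset.mem_range.1 hk)

theorem eq_of_forall_mul_mul_eq (hp : IsCentralPartition N p) (hq : IsCentralPartition N q)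
    {x y : R} (h : ∀ j < N, ∀ k < N, p j * q k * x = p j * q k * y) : x = y :=
  hp.eq_of_forall_mul_eq fun j hj => hq.eq_of_forall_mul_eq fun k hk => by
    rw [← mul_assoc, ← mul_assoc, hq.central, h j hj k hk]

/-- The element that agrees with `x j k` on the piece `p j * q k`. -/
def glue (N : ℕ) (p q : ℕ → R) (x : ℕ → ℕ → R) : R :=
  ∑ j ∈ Finset.range N, ∑ k ∈ Finset.range N, p j * q k * x j k

theorem mul_glue (hp : IsCentralPartition N p) (hq : IsCentralPartition N q)
    (x : ℕ → ℕ → R) {j k : ℕ} (hj : j < N) (hk : k < N) :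
    p j * q k * glue N p q x = p j * q k * x j k := by
  have key : ∀ j' k', p j * q k * (p j' * q k' * x j' k') =
      (p j * p j') * ((q k * q k') * x j' k') := fun j' k' => by
    rw [← mul_assoc, mul_assoc (p j), ← mul_assoc (q k) (p j'), hq.central k (p j')]
    simp only [mul_assoc]
  unfold glue
  rw [Finset.mul_sum, Finset.sum_eq_single j, Finset.mul_sum, Finset.sum_eq_single k, key,
    hp.idem hj, hq.idem hk, ← mul_assoc]
  · intro b _ hb
    rw [key, hq.orth _ _ hb.symm, zero_mul, mul_zero]
  · exact fun h => absurd (Finset.mem_range.2 hk) h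
  · intro b _ hb
    rw [Finset.mul_sum]
    refine Finset.sum_eq_zero fun c _ => ?_
    rw [key, hp.orth _ _ hb.symm, zero_mul]
  · exact fun h => absurd (Finset.mem_range.2 hj) h

end IsCentralPartition

/-! ### The partition of `1` around each integer. -/

namespace TwistedPartialAction

variable {R : Type u} [Ring R] (α : TwistedPartialAction R) (s : ℕ → ℤ)

/-- The part of `1` not covered by the idempotents `e (g + s l)` with `l < k`. -/
def uncovered (g : ℤ) : ℕ → R
  | 0 => 1
  | k + 1 => uncovered g k * (1 - α.e (g + s k))

/-- The part of `e (g + s k)` not covered by the idempotents `e (g + s l)` with `l < k`. -/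
def part (g : ℤ) (k : ℕ) : R := α.uncovered s g k * α.e (g + s k)

theorem uncovered_central (g : ℤ) (k : ℕ) (r : R) :
    α.uncovered s g k * r = r * α.uncovered s g k := by
  induction k generalizing r with
  | zero => simp [uncovered]
  | succ k ih =>
    exact central_mul ih (fun r => by rw [sub_mul, mul_sub, α.e_central, one_mul, mul_one]) r

theorem part_central (g : ℤ) (k : ℕ) (r : R) : α.part s g k * r = r * α.part s g k :=
  central_mul (α.uncovered_central s g k) (α.e_central _) r

theorem sum_part (g : ℤ) (n : ℕ) :
    ∑ k ∈ Finset.range n, α.part s g k = 1 - α.uncovered s g n := by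
  induction n with
  | zero => simp [uncovered]
  | succ n ih =>
    rw [Finset.sum_range_succ, ih, part, uncovered, mul_sub, mul_one]
    abel

theorem e_mul_uncovered (g : ℤ) {k n : ℕ} (h : k < n) :
    α.e (g + s k) * α.uncovered s g n = 0 := by
  induction n with
  | zero => omega
  | succ n ih =>
    rw [uncovered]
    rcases Nat.lt_succ_iff_lt_or_eq.1 h with h | rfl
    · rw [← mul_assoc, ih h, zero_mul]
    · rw [← mul_assoc, α.e_central, mul_assoc, mul_sub, mul_one, α.e_idem, sub_self, mul_zero]

theorem e_mul_part (g : ℤ) (k : ℕ) : α.e (g + s k) * α.part s g k = α.part s g k := by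
  rw [part, ← mul_assoc, α.e_central, mul_assoc, α.e_idem]

theorem part_mul_part_of_lt (g : ℤ) {j k : ℕ} (h : j < k) :
    α.part s g j * α.part s g k = 0 := by
  rw [part, part, mul_assoc, ← mul_assoc (α.e _), α.e_mul_uncovered s g h, zero_mul, mul_zero]

theorem part_mul_part (g : ℤ) (j k : ℕ) (h : j ≠ k) : α.part s g j * α.part s g k = 0 := by
  rcases lt_or_gt_of_ne h with h | h
  · exact α.part_mul_part_of_lt s g h
  · rw [α.part_central, α.part_mul_part_of_lt s g h]

theorem act_uncovered (m g : ℤ) (k : ℕ) :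
    α.act m (α.uncovered s g k) = α.e m * α.uncovered s (m + g) k := by
  induction k with
  | zero => simp [uncovered, α.act_one]
  | succ k ih =>
    rw [uncovered, map_mul, ih, map_sub, α.act_one, α.act_e, uncovered, ← add_assoc,
      ← mul_one_sub, ← mul_assoc, mul_assoc (α.e m), ← α.e_central m, ← mul_assoc,
      ← mul_assoc, α.e_idem]

/-- Equivariance of the partitions: they are built from the `e (g + s l)` by one formula for all
`g`, and `act m` shifts these idempotents up to the factor `e m`. -/
theorem act_part (m g : ℤ) (k : ℕ) :
    α.act m (α.part s g k) = α.e m * α.part s (m + g) k := by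
  rw [part, map_mul, α.act_uncovered, α.act_e, part, ← add_assoc, mul_assoc (α.e m),
    ← mul_assoc _ (α.e m), ← α.e_central m, ← mul_assoc, ← mul_assoc, α.e_idem, mul_assoc]

/-- Finitely many shifts, the first of them `0`, whose ideals cover `R` around every `g`. -/
structure FiniteCover where
  shift : ℕ → ℤ
  card : ℕ
  card_pos : 0 < card
  shift_zero : shift 0 = 0
  uncovered_eq_zero : ∀ g, α.uncovered shift g card = 0

variable {α} in
theorem IsOfFiniteType.nonempty_finiteCover (h : α.IsOfFiniteType) : Nonempty α.FiniteCover := by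
  obtain ⟨S, hS⟩ := h
  -- Prepending the shift `0` makes the first piece around `g` equal to `e g`. The default value of
  -- `getD` only affects indices beyond `card`.
  let L := 0 :: S.toList
  refine ⟨⟨fun k => L.getD k 0, L.length, by simp [L], by simp [L], fun g => ?_⟩⟩
  set x := α.uncovered (fun k => L.getD k 0) g L.length with hx
  have hk : ∀ k ∈ S, α.e (g + k) * x = 0 := by
    intro k hk
    obtain ⟨n, hn, rfl⟩ := List.mem_iff_getElem.1 (List.mem_cons_of_mem 0 (Finset.mem_toList.2 hk))
    have := α.e_mul_uncovered (fun k => L.getD k 0) g (k := n) hn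
    rwa [List.getD_eq_getElem _ _ hn] at this
  -- The annihilator of the uncovered part contains every `D (g + k)` with `k ∈ S`, hence contains
  -- `1`.
  let I : TwoSidedIdeal R := TwoSidedIdeal.mk' {r | r * x = 0} (zero_mul x)
    (fun {a b} ha hb => by
      simp only [Set.mem_ofPred_eq] at *
      rw [add_mul, ha, hb, add_zero])
    (fun {a} ha => by
      simp only [Set.mem_ofPred_eq] at *
      rw [neg_mul, ha, neg_zero])
    (fun {a b} hb => by
      simp only [Set.mem_ofPred_eq] at *
      rw [mul_assoc, hb, mul_zero])
    (fun {a b} ha => by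
      simp only [Set.mem_ofPred_eq] at *
      rw [mul_assoc, ← α.uncovered_central, ← mul_assoc, ha, zero_mul])
  have hI : ∀ r, r ∈ I ↔ r * x = 0 := fun r => by simp [I]
  have hle : (⨆ k ∈ S, α.D (g + k)) ≤ I := by
    refine iSup₂_le fun k hk' => ?_
    rw [α.D_eq]
    refine TwoSidedIdeal.span_le.2 ?_
    rintro _ rfl
    exact (hI _).2 (hk k hk')
  rw [hS g] at hle
  have h1 : (1 : R) ∈ I := hle trivial
  rwa [hI, one_mul] at h1

/-! ### Extension of the twist to units of `R`. -/

namespace FiniteCover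

variable {α} (c : α.FiniteCover)

theorem isCentralPartition (g : ℤ) : IsCentralPartition c.card (α.part c.shift g) where
  central := α.part_central c.shift g
  orth := α.part_mul_part c.shift g
  sum_eq_one := by rw [α.sum_part, c.uncovered_eq_zero, sub_zero]

theorem part_zero (g : ℤ) : α.part c.shift g 0 = α.e g := by
  simp [part, uncovered, c.shift_zero]

/-- The extension of `w g h` to an invertible element of `R`. -/
def W (g h : ℤ) : R :=
  IsCentralPartition.glue c.card (α.part c.shift g) (α.part c.shift (g + h))
    fun j k => α.w (g + c.shift j) (h + c.shift k - c.shift j)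

/-- The inverse of the extension of `w g h`. -/
def Winv (g h : ℤ) : R :=
  IsCentralPartition.glue c.card (α.part c.shift g) (α.part c.shift (g + h))
    fun j k => α.winv (g + c.shift j) (h + c.shift k - c.shift j)

theorem part_mul_W (g h : ℤ) {j k : ℕ} (hj : j < c.card) (hk : k < c.card) :
    α.part c.shift g j * α.part c.shift (g + h) k * c.W g h =
      α.part c.shift g j * α.part c.shift (g + h) k *
        α.w (g + c.shift j) (h + c.shift k - c.shift j) :=
  (c.isCentralPartition g).mul_glue (c.isCentralPartition (g + h)) _ hj hk

theorem part_mul_Winv (g h : ℤ) {j k : ℕ} (hj : j < c.card) (hk : k < c.card) :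
    α.part c.shift g j * α.part c.shift (g + h) k * c.Winv g h =
      α.part c.shift g j * α.part c.shift (g + h) k *
        α.winv (g + c.shift j) (h + c.shift k - c.shift j) :=
  (c.isCentralPartition g).mul_glue (c.isCentralPartition (g + h)) _ hj hk

theorem part_mul_part_central (g h : ℤ) (j k : ℕ) (r : R) :
    α.part c.shift g j * α.part c.shift h k * r = r * (α.part c.shift g j * α.part c.shift h k) :=
  central_mul (α.part_central _ _ _) (α.part_central _ _ _) r

theorem part_mul_part_mul_e (g h : ℤ) (j k : ℕ) :
    α.part c.shift g j * α.part c.shift (g + h) k *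
      (α.e (g + c.shift j) * α.e (g + c.shift j + (h + c.shift k - c.shift j))) =
      α.part c.shift g j * α.part c.shift (g + h) k := by
  rw [show g + c.shift j + (h + c.shift k - c.shift j) = g + h + c.shift k by ring,
    mul_assoc, ← mul_assoc _ (α.e _), ← α.e_central _ (α.part _ _ _), mul_assoc (α.e _),
    ← α.e_central _ (α.part _ _ _), α.e_mul_part, ← mul_assoc, ← α.e_central _ (α.part _ _ _),
    α.e_mul_part]

theorem W_mul_Winv (g h : ℤ) : c.W g h * c.Winv g h = 1 := by
  refine (c.isCentralPartition g).eq_of_forall_mul_mul_eq (c.isCentralPartition (g + h))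
    fun j hj k hk => ?_
  rw [central_mul_congr (c.part_mul_part_central _ _ _ _) (c.part_mul_W g h hj hk)
    (c.part_mul_Winv g h hj hk), α.w_mul_winv, c.part_mul_part_mul_e, mul_one]

theorem Winv_mul_W (g h : ℤ) : c.Winv g h * c.W g h = 1 := by
  refine (c.isCentralPartition g).eq_of_forall_mul_mul_eq (c.isCentralPartition (g + h))
    fun j hj k hk => ?_
  rw [central_mul_congr (c.part_mul_part_central _ _ _ _) (c.part_mul_Winv g h hj hk)
    (c.part_mul_W g h hj hk), α.winv_mul_w, c.part_mul_part_mul_e, mul_one]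

/-- The extension of `w g h` as a unit of `R`. -/
def unit (g h : ℤ) : Rˣ := ⟨c.W g h, c.Winv g h, c.W_mul_Winv g h, c.Winv_mul_W g h⟩

/-- The piece with `j = k = 0`, where both shifts vanish. -/
theorem e_mul_unit (g h : ℤ) : α.e g * α.e (g + h) * (c.unit g h : R) = α.w g h := by
  have := c.part_mul_W g h c.card_pos c.card_pos
  simp only [c.part_zero, c.shift_zero, α.e_mul_w, add_zero, sub_zero] at this
  exact this

theorem e_mul_unit_inv (g h : ℤ) :
    α.e g * α.e (g + h) * (↑(c.unit g h)⁻¹ : R) = α.winv g h := by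
  have := c.part_mul_Winv g h c.card_pos c.card_pos
  simp only [c.part_zero, c.shift_zero, α.e_mul_winv, add_zero, sub_zero] at this
  exact this

theorem unit_zero_left (h : ℤ) : c.unit 0 h = 1 := by
  refine Units.ext ((c.isCentralPartition (0 + h)).eq_of_forall_mul_eq fun k hk => ?_)
  have := c.part_mul_W 0 h c.card_pos hk
  simp only [c.part_zero, c.shift_zero, α.e_zero, one_mul, add_zero, sub_zero,
    α.w_zero_left] at this
  rw [Units.val_one, mul_one]
  refine this.trans ?_
  rw [← α.e_central, zero_add, α.e_mul_part]

/-- Both partitions are the one around `g`, so only the diagonal pieces survive, and there the local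
value is `w (g + s_j) 0`, an idempotent that fixes the piece. -/
theorem unit_zero_right (g : ℤ) : c.unit g 0 = 1 := by
  refine Units.ext ((c.isCentralPartition g).eq_of_forall_mul_eq fun k hk => ?_)
  have := c.part_mul_W g 0 hk hk
  simp only [add_zero, zero_add, sub_self, α.w_zero_right,
    (c.isCentralPartition g).idem hk] at this
  rw [Units.val_one, mul_one]
  refine this.trans ?_
  rw [← α.e_central, α.e_mul_part]

/-- On each piece this is `act_w` for the triple `m`, `g + s_j`, `h + s_k - s_j`. -/
theorem act_unit_mul (m g h : ℤ) :
    α.act m (c.unit g h) * c.unit m (g + h) = α.e m * (c.unit m g * c.unit (m + g) h : R) := by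
  change α.act m (c.W g h) * c.W m (g + h) = α.e m * (c.W m g * c.W (m + g) h)
  have he : α.act m (c.W g h) * c.W m (g + h) =
      α.e m * (α.act m (c.W g h) * c.W m (g + h)) := by rw [← mul_assoc, α.e_mul_act]
  -- With `e m` in front of both sides, only piece `0` of the partition around `m` matters; the
  -- partitions around `m + g` and `m + g + h` are then refined.
  rw [he]
  refine (c.isCentralPartition (m + g)).eq_of_forall_mul_mul_eq
    (c.isCentralPartition (m + g + h)) fun j hj k hk => ?_
  rw [← mul_assoc _ (α.e m), ← mul_assoc _ (α.e m)]
  set P := α.part c.shift (m + g) j with hP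
  set Q := α.part c.shift (m + g + h) k with hQ
  have hPc : ∀ r, P * r = r * P := α.part_central _ _ _
  have hQc : ∀ r, Q * r = r * Q := α.part_central _ _ _
  have hz : ∀ r, P * Q * α.e m * r = r * (P * Q * α.e m) :=
    central_mul (central_mul hPc hQc) (α.e_central m)
  have hact : P * Q * α.e m * α.act m (c.W g h) =
      P * Q * α.e m * α.act m (α.w (g + c.shift j) (h + c.shift k - c.shift j)) := by
    have h1 : P * Q * α.e m = α.act m (α.part c.shift g j * α.part c.shift (g + h) k) := by
      rw [map_mul, α.act_part, α.act_part, ← add_assoc, ← hP, ← hQ, ← α.e_central,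
        mul_assoc (α.e m) P, ← mul_assoc P, ← α.e_central m P, ← mul_assoc (α.e m),
        ← mul_assoc (α.e m), ← mul_assoc (α.e m), α.e_idem, mul_assoc]
    rw [h1, ← map_mul, ← map_mul, c.part_mul_W g h hj hk]
  have hW : P * Q * α.e m * c.W m (g + h) =
      P * Q * α.e m * α.w m (g + c.shift j + (h + c.shift k - c.shift j)) := by
    have := c.part_mul_W m (g + h) c.card_pos hk
    rw [c.part_zero, c.shift_zero, ← add_assoc, ← hQ, add_zero, sub_zero] at this
    rw [mul_assoc P, ← α.e_central m Q, mul_assoc P, mul_assoc P, this]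
    congr 3; ring
  have hW1 : P * Q * α.e m * c.W m g = P * Q * α.e m * α.w m (g + c.shift j) := by
    have := c.part_mul_W m g c.card_pos hj
    rw [c.part_zero, c.shift_zero, ← hP, add_zero, sub_zero] at this
    rw [hPc Q, mul_assoc Q, ← α.e_central m P, mul_assoc Q, mul_assoc Q, this]
  have hW2 : P * Q * α.e m * c.W (m + g) h =
      P * Q * α.e m * α.w (m + (g + c.shift j)) (h + c.shift k - c.shift j) := by
    have := c.part_mul_W (m + g) h hj hk
    rw [← hP, ← hQ] at this
    rw [← α.e_central m, mul_assoc (α.e m), mul_assoc (α.e m), this, add_assoc]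
  rw [central_mul_congr hz hact hW, central_mul_congr hz hW1 hW2, α.act_w]

end FiniteCover

end TwistedPartialAction

/-! ### Multipliers of a subring given by elements of the ambient ring. -/

namespace RingMultiplier

variable {A : Type u} [Ring A] (S : NonUnitalSubring A)

/-- An element of a ring which preserves a subring on both sides is a multiplier of it. -/
def ofElement (m : A) (hl : ∀ t ∈ S, m * t ∈ S) (hr : ∀ t ∈ S, t * m ∈ S) : RingMultiplier S where
  lmul := ((AddMonoidHom.mulLeft m).comp (AddSubmonoidClass.subtype S)).codRestrict S
    fun t => hl t t.2
  rmul := ((AddMonoidHom.mulRight m).comp (AddSubmonoidClass.subtype S)).codRestrict S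
    fun t => hr t t.2
  lmul_mul a b := Subtype.ext (mul_assoc m a b).symm
  mul_rmul a b := Subtype.ext (mul_assoc (a : A) b m)
  rmul_mul a b := Subtype.ext (mul_assoc (a : A) m b)

/-- A unit of a ring which, together with its inverse, preserves a subring on both sides is an
invertible multiplier of it. -/
def ofUnit (m : Aˣ) (hl : ∀ t ∈ S, (m : A) * t ∈ S) (hr : ∀ t ∈ S, t * (m : A) ∈ S)
    (hl' : ∀ t ∈ S, (↑m⁻¹ : A) * t ∈ S) (hr' : ∀ t ∈ S, t * (↑m⁻¹ : A) ∈ S) :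
    (RingMultiplier S)ˣ where
  val := ofElement S m hl hr
  inv := ofElement S (↑m⁻¹ : A) hl' hr'
  val_inv := RingMultiplier.ext
    (AddMonoidHom.ext fun t => Subtype.ext (Units.mul_inv_cancel_left m (t : A)))
    (AddMonoidHom.ext fun t => Subtype.ext (Units.mul_inv_cancel_right (t : A) m))
  inv_val := RingMultiplier.ext
    (AddMonoidHom.ext fun t => Subtype.ext (Units.inv_mul_cancel_left m (t : A)))
    (AddMonoidHom.ext fun t => Subtype.ext (Units.inv_mul_cancel_right (t : A) m))

end RingMultiplier

/-! ### The global action on functions `ℤ → R`. -/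

namespace TwistedPartialAction

variable {R : Type u} [Ring R] (α : TwistedPartialAction R)

theorem act_mul_e (i : ℤ) (a : R) : α.act i a * α.e i = α.act i a := by
  rw [← α.e_central, α.e_mul_act]

/-- The embedding of `R` into the functions on `ℤ`, by `a ↦ (n ↦ α.act n a)`. -/
def emb : R →ₙ+* (ℤ → R) where
  toFun a n := α.act n a
  map_mul' _ _ := funext fun _ => map_mul _ _ _
  map_zero' := funext fun _ => map_zero _
  map_add' _ _ := funext fun _ => map_add _ _ _

theorem emb_injective : Function.Injective α.emb := fun a b h => by
  have : α.act 0 a = α.act 0 b := congrFun h 0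
  rwa [α.act_zero, α.act_zero] at this

/-- `α.act m` sends the unit `x` to the restriction of the unit `y`. -/
def ActsTo (m : ℤ) (x y : Rˣ) : Prop := α.act m x = α.e m * y

namespace ActsTo

variable {α} {m : ℤ} {x y x' y' : Rˣ}

theorem mul (h : α.ActsTo m x y) (h' : α.ActsTo m x' y') : α.ActsTo m (x * x') (y * y') := by
  unfold ActsTo at *
  rw [Units.val_mul, map_mul, h, h', Units.val_mul, mul_assoc, ← mul_assoc (y : R),
    ← α.e_central m, ← mul_assoc, ← mul_assoc, α.e_idem, mul_assoc]

theorem inv (h : α.ActsTo m x y) : α.ActsTo m x⁻¹ y⁻¹ := by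
  unfold ActsTo at *
  have h1 : α.act m (↑x⁻¹ : R) * α.act m x = α.e m := by
    rw [← map_mul, Units.inv_mul, α.act_one]
  rw [h, ← mul_assoc, α.act_mul_e] at h1
  rw [← h1, Units.mul_inv_cancel_right]

end ActsTo

namespace FiniteCover

variable {α} (c : α.FiniteCover)

/-- The value at `n` of the global twisting multiplier. -/
def twistAt (g h n : ℤ) : Rˣ := c.unit n g * c.unit (n + g) h * (c.unit n (g + h))⁻¹

theorem actsTo_unit (m g h : ℤ) : α.ActsTo m (c.unit g h) (c.twistAt g h m) := by
  unfold ActsTo twistAt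
  rw [Units.val_mul, Units.val_mul, ← mul_assoc, ← c.act_unit_mul, Units.mul_inv_cancel_right]

/-- The unit of `R` through which `twist g h` acts on the `k`-th translate of `R`. -/
def localTwist (k g h : ℤ) : Rˣ := (c.unit (-k) k)⁻¹ * c.twistAt g h (-k) * c.unit (-k) k

/-- The case `n = -k`, where `act 0` is the identity, forces the choice of `localTwist`. For other
`n`, `actsTo_unit` is applied to each factor and the auxiliary units `unit (n + k) _` telescope. -/
theorem actsTo_localTwist (n k g h : ℤ) :
    α.ActsTo (n + k) (c.localTwist k g h)
      ((c.unit n k)⁻¹ * c.twistAt g h n * c.unit n k) := by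
  have := ((c.actsTo_unit (n + k) (-k) k).inv.mul
    (((c.actsTo_unit (n + k) (-k) g).mul (c.actsTo_unit (n + k) (-k + g) h)).mul
      (c.actsTo_unit (n + k) (-k) (g + h)).inv)).mul (c.actsTo_unit (n + k) (-k) k)
  have heq : ((c.unit n k)⁻¹ * c.twistAt g h n * c.unit n k) = (c.twistAt (-k) k (n + k))⁻¹ *
      (c.twistAt (-k) g (n + k) * c.twistAt (-k + g) h (n + k) *
        (c.twistAt (-k) (g + h) (n + k))⁻¹) * c.twistAt (-k) k (n + k) := by
    unfold twistAt
    rw [← add_assoc (-k) g h, ← add_assoc (n + k) (-k) g, add_neg_cancel_right, neg_add_cancel,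
      c.unit_zero_right]
    group
  rw [heq]
  exact this

/-- Since `act (n + l) b` lies in `D (n + l)`, the factor `e n` reduces `unit n l` to `w n l`, and
`act_act` applies. -/
theorem e_mul_conj_act (n l : ℤ) (b : R) :
    α.e n * (c.unit n l * α.act (n + l) b * (↑(c.unit n l)⁻¹ : R)) = α.act n (α.act l b) := by
  rw [α.act_act, ← c.e_mul_unit, ← c.e_mul_unit_inv, α.e_mul_central n (n + l) (↑(c.unit n l)⁻¹),
    ← mul_assoc _ _ (α.e n * α.e (n + l)), ← α.e_mul_central n (n + l)]
  simp only [← mul_assoc]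
  rw [mul_assoc (α.e n * α.e (n + l)) (α.e n), α.e_mul_idem, mul_assoc (α.e n) (α.e (n + l)),
    α.e_central (n + l), ← mul_assoc (α.e n), mul_assoc _ (α.e (n + l)), α.e_mul_act]

/-- The twisted translation by `g` on the functions on `ℤ`. -/
def translate (g : ℤ) : (ℤ → R) ≃+* (ℤ → R) where
  toFun f n := c.unit n g * f (n + g) * (↑(c.unit n g)⁻¹ : R)
  invFun f n := (↑(c.unit (n - g) g)⁻¹ : R) * f (n - g) * c.unit (n - g) g
  left_inv f := funext fun n => by simp [mul_assoc]
  right_inv f := funext fun n => by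
    simp only [add_sub_cancel_right]
    simp [mul_assoc]
  map_mul' f f' := funext fun n => by simp [mul_assoc]
  map_add' f f' := funext fun n => by simp [mul_add, add_mul]

theorem translate_apply (g : ℤ) (f : ℤ → R) (n : ℤ) :
    c.translate g f n = c.unit n g * f (n + g) * (↑(c.unit n g)⁻¹ : R) := rfl

/-- The global twisting, as a unit of the ring of functions on `ℤ`. -/
def twist (g h : ℤ) : (ℤ → R)ˣ where
  val n := c.twistAt g h n
  inv n := (↑(c.twistAt g h n)⁻¹ : R)
  val_inv := funext fun _ => Units.mul_inv _
  inv_val := funext fun _ => Units.inv_mul _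

theorem twist_apply (g h n : ℤ) : (c.twist g h : ℤ → R) n = c.twistAt g h n := rfl

theorem twist_inv_apply (g h n : ℤ) :
    (↑(c.twist g h)⁻¹ : ℤ → R) n = (↑(c.twistAt g h n)⁻¹ : R) := rfl

theorem translate_zero (f : ℤ → R) : c.translate 0 f = f :=
  funext fun n => by simp [translate_apply, c.unit_zero_right]

theorem twist_zero_right (g : ℤ) : c.twist g 0 = 1 :=
  Units.ext (funext fun n => by simp [twist_apply, twistAt, c.unit_zero_right])

theorem twist_zero_left (g : ℤ) : c.twist 0 g = 1 :=
  Units.ext (funext fun n => by simp [twist_apply, twistAt, c.unit_zero_right])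

theorem translate_translate (g h : ℤ) (f : ℤ → R) :
    c.translate g (c.translate h f) =
      c.twist g h * c.translate (g + h) f * (↑(c.twist g h)⁻¹ : ℤ → R) :=
  funext fun n => by
    simp only [translate_apply, Pi.mul_apply, twist_apply, twist_inv_apply, twistAt, add_assoc]
    simp [mul_assoc]

theorem translate_twist (g h k : ℤ) :
    c.translate g (c.twist h k) * c.twist g (h + k) = (c.twist g h * c.twist (g + h) k : ℤ → R) :=
  funext fun n => by
    simp only [translate_apply, Pi.mul_apply, twist_apply, twistAt, add_assoc]
    simp [mul_assoc]

theorem twist_mul_translate (g h k : ℤ) (a : R) :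
    c.twist g h * c.translate k (α.emb a) =
      c.translate k (α.emb (c.localTwist k g h * a)) :=
  funext fun n => by
    have h1 : α.act (n + k) (c.localTwist k g h) = _ := c.actsTo_localTwist n k g h
    change (c.twistAt g h n : R) * (c.unit n k * α.act (n + k) a * (↑(c.unit n k)⁻¹ : R)) =
      c.unit n k * α.act (n + k) (c.localTwist k g h * a) * (↑(c.unit n k)⁻¹ : R)
    rw [map_mul, h1, α.e_central, mul_assoc _ (α.e _), α.e_mul_act]
    simp [mul_assoc]

theorem translate_mul_twist (g h k : ℤ) (a : R) :
    c.translate k (α.emb a) * c.twist g h =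
      c.translate k (α.emb (a * c.localTwist k g h)) :=
  funext fun n => by
    have h1 : α.act (n + k) (c.localTwist k g h) = _ := c.actsTo_localTwist n k g h
    change (c.unit n k * α.act (n + k) a * (↑(c.unit n k)⁻¹ : R)) * (c.twistAt g h n : R) =
      c.unit n k * α.act (n + k) (a * c.localTwist k g h) * (↑(c.unit n k)⁻¹ : R)
    rw [map_mul, h1, ← mul_assoc (α.act _ _), α.act_mul_e]
    simp [mul_assoc]

theorem twist_inv_mul_translate (g h k : ℤ) (a : R) :
    (↑(c.twist g h)⁻¹ : ℤ → R) * c.translate k (α.emb a) =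
      c.translate k (α.emb ((↑(c.localTwist k g h)⁻¹ : R) * a)) := by
  rw [Units.inv_mul_eq_iff_eq_mul, twist_mul_translate, Units.mul_inv_cancel_left]

theorem translate_mul_twist_inv (g h k : ℤ) (a : R) :
    c.translate k (α.emb a) * (↑(c.twist g h)⁻¹ : ℤ → R) =
      c.translate k (α.emb (a * (↑(c.localTwist k g h)⁻¹ : R))) := by
  rw [Units.mul_inv_eq_iff_eq_mul, translate_mul_twist, Units.inv_mul_cancel_right]

theorem emb_mul_translate (l : ℤ) (a b : R) :
    α.emb a * c.translate l (α.emb b) = α.emb (a * α.act l b) :=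
  funext fun n => by
    change α.act n a * (c.unit n l * α.act (n + l) b * (↑(c.unit n l)⁻¹ : R)) =
      α.act n (a * α.act l b)
    rw [map_mul, ← c.e_mul_conj_act, ← mul_assoc (α.act n a) (α.e n), α.act_mul_e]

theorem translate_mul_emb (l : ℤ) (a b : R) :
    c.translate l (α.emb b) * α.emb a = α.emb (α.act l b * a) :=
  funext fun n => by
    change c.unit n l * α.act (n + l) b * (↑(c.unit n l)⁻¹ : R) * α.act n a =
      α.act n (α.act l b * a)
    rw [map_mul, ← c.e_mul_conj_act, α.e_central n, mul_assoc _ (α.e n), α.e_mul_act]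

theorem emb_act (l : ℤ) {a : R} (ha : a ∈ α.D (-l)) :
    α.emb (α.act l a) = c.translate l (α.emb a) :=
  funext fun n => by
    change α.act n (α.act l a) = c.unit n l * α.act (n + l) a * (↑(c.unit n l)⁻¹ : R)
    -- As `a` lies in `D (-l)`, its image lies in `D (n + l) * D n`, so the factor `e n` of
    -- `e_mul_conj_act` can be dropped.
    have h1 : α.e n * α.act (n + l) a = α.act (n + l) a := by
      conv_rhs => rw [← α.mem_D.1 ha, map_mul, α.act_e, add_neg_cancel_right, mul_assoc,
        α.e_central n, ← mul_assoc, α.e_mul_act]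
      rw [α.e_central]
    rw [← c.e_mul_conj_act, ← mul_assoc, ← mul_assoc, α.e_central n, mul_assoc _ (α.e n), h1]

theorem emb_mul_w (i j : ℤ) {a : R} (ha : a ∈ idealProd (α.D i) (α.D (i + j))) :
    α.emb (a * α.w i j) = α.emb a * c.twist i j :=
  funext fun n => by
    change α.act n (a * α.w i j) = α.act n a * c.twistAt i j n
    have h1 : α.act n (c.unit i j) = _ := c.actsTo_unit n i j
    rw [← c.e_mul_unit, ← mul_assoc, ← α.e_mul_central, α.mem_prod.1 ha, map_mul, h1,
      ← mul_assoc, α.act_mul_e]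

theorem emb_w_mul (i j : ℤ) {a : R} (ha : a ∈ idealProd (α.D i) (α.D (i + j))) :
    α.emb (α.w i j * a) = c.twist i j * α.emb a :=
  funext fun n => by
    change α.act n (α.w i j * a) = c.twistAt i j n * α.act n a
    have h1 : α.act n (c.unit i j) = _ := c.actsTo_unit n i j
    rw [← c.e_mul_unit, α.e_mul_central, mul_assoc, α.mem_prod.1 ha, map_mul, h1,
      α.e_central, mul_assoc, α.e_mul_act]

/-! ### The enveloping ring and its action. -/

/-- The union of the translates of `R`. -/
def translates : Set (ℤ → R) := ⋃ k, Set.range fun a => c.translate k (α.emb a)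

theorem translate_emb_mem_translates (k : ℤ) (a : R) :
    c.translate k (α.emb a) ∈ c.translates :=
  Set.mem_iUnion.2 ⟨k, a, rfl⟩

theorem translate_mul_translate_mem {f f' : ℤ → R} (hf : f ∈ c.translates)
    (hf' : f' ∈ c.translates) : f * f' ∈ c.translates := by
  obtain ⟨k, a, rfl⟩ := Set.mem_iUnion.1 hf
  obtain ⟨l, b, rfl⟩ := Set.mem_iUnion.1 hf'
  have h := c.translate_translate k (l - k) (α.emb b)
  -- The `l`-th translate is written as the `k`-th translate of the `(l - k)`-th, conjugated by a
  -- twist. The twists are absorbed into the `k`-th translate, leaving a product with `emb` inside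
  -- it.
  rw [add_sub_cancel, eq_comm, Units.mul_inv_eq_iff_eq_mul, ← Units.eq_inv_mul_iff_mul_eq] at h
  change c.translate k (α.emb a) * c.translate l (α.emb b) ∈ c.translates
  rw [h, ← mul_assoc, translate_mul_twist_inv, ← mul_assoc, ← map_mul, emb_mul_translate,
    translate_mul_twist]
  exact c.translate_emb_mem_translates _ _

/-- The ring of the enveloping action: the sum of the translates of `R`. -/
def envelope : NonUnitalSubring (ℤ → R) :=
  { AddSubgroup.closure c.translates with
    mul_mem' := fun {f f'} hf hf' => by
      induction hf, hf' using AddSubgroup.closure_induction₂ with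
      | mem x y hx hy =>
        exact AddSubgroup.subset_closure (c.translate_mul_translate_mem hx hy)
      | zero_left x hx => rw [zero_mul]; exact zero_mem (AddSubgroup.closure c.translates)
      | zero_right x hx => rw [mul_zero]; exact zero_mem (AddSubgroup.closure c.translates)
      | add_left x y z _ _ _ h1 h2 => rw [add_mul]; exact AddSubgroup.add_mem _ h1 h2
      | add_right y z x _ _ _ h1 h2 => rw [mul_add]; exact AddSubgroup.add_mem _ h1 h2
      | neg_left x y _ _ h => rw [neg_mul]; exact AddSubgroup.neg_mem _ h
      | neg_right x y _ _ h => rw [mul_neg]; exact AddSubgroup.neg_mem _ h }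

theorem translate_emb_mem (k : ℤ) (a : R) : c.translate k (α.emb a) ∈ c.envelope :=
  AddSubgroup.subset_closure (c.translate_emb_mem_translates k a)

theorem emb_mem (a : R) : α.emb a ∈ c.envelope := by
  rw [← c.translate_zero (α.emb a)]
  exact c.translate_emb_mem 0 a

theorem envelope_induction {p : (ℤ → R) → Prop} (hp : ∀ k a, p (c.translate k (α.emb a)))
    (hzero : p 0) (hadd : ∀ x y, p x → p y → p (x + y)) (hneg : ∀ x, p x → p (-x))
    {t : ℤ → R} (ht : t ∈ c.envelope) : p t := by
  change t ∈ AddSubgroup.closure c.translates at ht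
  induction ht using AddSubgroup.closure_induction with
  | mem x hx =>
    obtain ⟨k, a, rfl⟩ := Set.mem_iUnion.1 hx
    exact hp k a
  | zero => exact hzero
  | add x y _ _ hx hy => exact hadd x y hx hy
  | neg x _ hx => exact hneg x hx

theorem map_mem_envelope (F : (ℤ → R) →+ (ℤ → R))
    (hF : ∀ k a, F (c.translate k (α.emb a)) ∈ c.envelope) {t : ℤ → R}
    (ht : t ∈ c.envelope) : F t ∈ c.envelope := by
  refine c.envelope_induction (p := fun t => F t ∈ c.envelope) hF ?_ ?_ ?_ ht
  · rw [map_zero]; exact zero_mem _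
  · intro x y hx hy; rw [map_add]; exact add_mem hx hy
  · intro x hx; rw [map_neg]; exact neg_mem hx

theorem twist_mul_mem (g h : ℤ) (t : ℤ → R) (ht : t ∈ c.envelope) :
    (c.twist g h : ℤ → R) * t ∈ c.envelope :=
  c.map_mem_envelope (AddMonoidHom.mulLeft (c.twist g h : ℤ → R))
    (fun k a => Set.mem_of_eq_of_mem (c.twist_mul_translate g h k a) (c.translate_emb_mem _ _)) ht

theorem mul_twist_mem (g h : ℤ) (t : ℤ → R) (ht : t ∈ c.envelope) :
    t * (c.twist g h : ℤ → R) ∈ c.envelope :=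
  c.map_mem_envelope (AddMonoidHom.mulRight (c.twist g h : ℤ → R))
    (fun k a => Set.mem_of_eq_of_mem (c.translate_mul_twist g h k a) (c.translate_emb_mem _ _)) ht

theorem twist_inv_mul_mem (g h : ℤ) (t : ℤ → R) (ht : t ∈ c.envelope) :
    (↑(c.twist g h)⁻¹ : ℤ → R) * t ∈ c.envelope :=
  c.map_mem_envelope (AddMonoidHom.mulLeft (↑(c.twist g h)⁻¹ : ℤ → R))
    (fun k a => Set.mem_of_eq_of_mem (c.twist_inv_mul_translate g h k a) (c.translate_emb_mem _ _)) ht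

theorem mul_twist_inv_mem (g h : ℤ) (t : ℤ → R) (ht : t ∈ c.envelope) :
    t * (↑(c.twist g h)⁻¹ : ℤ → R) ∈ c.envelope :=
  c.map_mem_envelope (AddMonoidHom.mulRight (↑(c.twist g h)⁻¹ : ℤ → R))
    (fun k a => Set.mem_of_eq_of_mem (c.translate_mul_twist_inv g h k a) (c.translate_emb_mem _ _)) ht

theorem translate_mem (g : ℤ) (t : ℤ → R) (ht : t ∈ c.envelope) :
    c.translate g t ∈ c.envelope := by
  refine c.map_mem_envelope (c.translate g : (ℤ → R) →+ (ℤ → R)) (fun k a => ?_) ht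
  change c.translate g (c.translate k (α.emb a)) ∈ c.envelope
  rw [c.translate_translate]
  exact c.mul_twist_inv_mem _ _ _ (c.twist_mul_mem _ _ _ (c.translate_emb_mem _ _))

theorem translate_symm_mem (g : ℤ) (t : ℤ → R) (ht : t ∈ c.envelope) :
    (c.translate g).symm t ∈ c.envelope := by
  refine c.map_mem_envelope ((c.translate g).symm : (ℤ → R) →+ (ℤ → R)) (fun k a => ?_) ht
  change (c.translate g).symm (c.translate k (α.emb a)) ∈ c.envelope
  -- The preimage is sought in the translate by `k - g`; conjugating `a` by `localTwist` cancels the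
  -- twist produced by composing translations.
  have h := c.translate_translate g (k - g) (α.emb
    ((↑(c.localTwist k g (k - g))⁻¹ : R) * a * c.localTwist k g (k - g)))
  rw [add_sub_cancel, twist_mul_translate, translate_mul_twist_inv, ← mul_assoc, ← mul_assoc,
    Units.mul_inv, one_mul, Units.mul_inv_cancel_right] at h
  rw [← h, RingEquiv.symm_apply_apply]
  exact c.translate_emb_mem _ _

/-- The global action on the envelope. -/
def envelopeAction : TwistedGlobalAction c.envelope where
  β g :=
    { toFun := fun t => ⟨c.translate g t, c.translate_mem g t t.2⟩
      invFun := fun t => ⟨(c.translate g).symm t, c.translate_symm_mem g t t.2⟩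
      left_inv := fun t => Subtype.ext ((c.translate g).symm_apply_apply t)
      right_inv := fun t => Subtype.ext ((c.translate g).apply_symm_apply t)
      map_mul' := fun t t' => Subtype.ext (map_mul (c.translate g) (t : ℤ → R) t')
      map_add' := fun t t' => Subtype.ext (map_add (c.translate g) (t : ℤ → R) t') }
  u g h := RingMultiplier.ofUnit c.envelope (c.twist g h) (c.twist_mul_mem g h)
    (c.mul_twist_mem g h) (c.twist_inv_mul_mem g h) (c.mul_twist_inv_mem g h)
  β_zero t := Subtype.ext (c.translate_zero t)
  β_comp i j t := Subtype.ext (c.translate_translate i j t)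
  u_zero_right i := Units.ext (RingMultiplier.ext
    (AddMonoidHom.ext fun t => Subtype.ext (by
      change (c.twist i 0 : ℤ → R) * t = t
      rw [c.twist_zero_right, Units.val_one, one_mul]))
    (AddMonoidHom.ext fun t => Subtype.ext (by
      change (t : ℤ → R) * (c.twist i 0 : ℤ → R) = t
      rw [c.twist_zero_right, Units.val_one, mul_one])))
  u_zero_left i := Units.ext (RingMultiplier.ext
    (AddMonoidHom.ext fun t => Subtype.ext (by
      change (c.twist 0 i : ℤ → R) * t = t
      rw [c.twist_zero_left, Units.val_one, one_mul]))
    (AddMonoidHom.ext fun t => Subtype.ext (by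
      change (t : ℤ → R) * (c.twist 0 i : ℤ → R) = t
      rw [c.twist_zero_left, Units.val_one, mul_one])))
  cocycle i j k t := Subtype.ext (by
    change c.translate i ((t : ℤ → R) * c.twist j k) * c.twist i (j + k) =
      c.translate i (t : ℤ → R) * c.twist i j * c.twist (i + j) k
    rw [map_mul, mul_assoc, c.translate_twist, mul_assoc])

/-- The embedding of `R` into the envelope. -/
def embEnvelope : R →ₙ+* c.envelope where
  toFun a := ⟨α.emb a, c.emb_mem a⟩
  map_mul' a b := Subtype.ext (map_mul α.emb a b)
  map_zero' := Subtype.ext (map_zero α.emb)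
  map_add' a b := Subtype.ext (map_add α.emb a b)

theorem exists_emb_eq_mul_emb (r : R) {t : ℤ → R} (ht : t ∈ c.envelope) :
    ∃ a, α.emb a = t * α.emb r := by
  refine c.envelope_induction (p := fun t => ∃ a, α.emb a = t * α.emb r)
    (fun k a => ⟨_, (c.translate_mul_emb k r a).symm⟩) ⟨0, by rw [map_zero, zero_mul]⟩ ?_ ?_ ht
  · rintro x y ⟨a, ha⟩ ⟨b, hb⟩
    exact ⟨a + b, by rw [map_add, ha, hb, add_mul]⟩
  · rintro x ⟨a, ha⟩
    exact ⟨-a, by rw [map_neg, ha, neg_mul]⟩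

theorem exists_emb_eq_emb_mul (r : R) {t : ℤ → R} (ht : t ∈ c.envelope) :
    ∃ a, α.emb a = α.emb r * t := by
  refine c.envelope_induction (p := fun t => ∃ a, α.emb a = α.emb r * t)
    (fun k a => ⟨_, (c.emb_mul_translate k r a).symm⟩) ⟨0, by rw [map_zero, mul_zero]⟩ ?_ ?_ ht
  · rintro x y ⟨a, ha⟩ ⟨b, hb⟩
    exact ⟨a + b, by rw [map_add, ha, hb, mul_add]⟩
  · rintro x ⟨a, ha⟩
    exact ⟨-a, by rw [map_neg, ha, mul_neg]⟩

theorem sum_translates_eq_top :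
    AddSubgroup.closure (⋃ i : ℤ, c.envelopeAction.β i '' Set.range c.embEnvelope) = ⊤ := by
  set C := AddSubgroup.closure (⋃ i : ℤ, c.envelopeAction.β i '' Set.range c.embEnvelope)
  refine (AddSubgroup.eq_top_iff' _).2 fun ⟨t, ht⟩ => ?_
  obtain ⟨x, hx, rfl⟩ := c.envelope_induction (p := fun t => ∃ x ∈ C, (x : ℤ → R) = t)
    (fun k a => ⟨c.envelopeAction.β k (c.embEnvelope a),
      AddSubgroup.subset_closure (Set.mem_iUnion.2 ⟨k, _, ⟨a, rfl⟩, rfl⟩), rfl⟩)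
    ⟨0, zero_mem _, rfl⟩
    (by rintro _ _ ⟨x, hx, rfl⟩ ⟨y, hy, rfl⟩; exact ⟨x + y, add_mem hx hy, rfl⟩)
    (by rintro _ ⟨x, hx, rfl⟩; exact ⟨-x, neg_mem hx, rfl⟩) ht
  exact hx

theorem isEnvelopingVia : IsEnvelopingVia α c.envelopeAction c.embEnvelope where
  injective a b h := α.emb_injective (congrArg Subtype.val h)
  mul_mem_left t r :=
    let ⟨a, ha⟩ := c.exists_emb_eq_mul_emb r t.2
    ⟨a, Subtype.ext ha⟩
  mul_mem_right t r :=
    let ⟨a, ha⟩ := c.exists_emb_eq_emb_mul r t.2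
    ⟨a, Subtype.ext ha⟩
  sum_eq_top := c.sum_translates_eq_top
  map_D i := by
    ext t
    constructor
    · rintro ⟨a, ha, rfl⟩
      refine ⟨⟨a, rfl⟩, ?_⟩
      obtain ⟨b, hb⟩ := (α.α i).surjective ⟨a, ha⟩
      refine ⟨_, ⟨b, rfl⟩, Subtype.ext ?_⟩
      have h1 : α.act i b = a := by rw [← α.act_of_mem b.2, hb]
      exact (c.emb_act i b.2).symm.trans (congrArg α.emb h1)
    · rintro ⟨⟨a, rfl⟩, ⟨_, ⟨b, rfl⟩, h⟩⟩
      refine ⟨a, ?_, rfl⟩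
      -- Evaluation at `0` recovers `a`, while the translate of `b` takes the value `act i b`, which
      -- lies in `D i`.
      have h0 : (c.unit 0 i * α.act (0 + i) b * (↑(c.unit 0 i)⁻¹ : R)) = α.act 0 a :=
        congrFun (congrArg Subtype.val h) 0
      rw [c.unit_zero_left, α.act_zero, zero_add, inv_one, Units.val_one, one_mul, mul_one] at h0
      rw [← h0]
      exact α.act_mem i b
  map_α i a := Subtype.ext (by
    rw [α.act_of_mem a.2]
    exact c.emb_act i a.2)
  map_mul_w i j a ha := Subtype.ext (c.emb_mul_w i j ha)
  map_w_mul i j a ha := Subtype.ext (c.emb_w_mul i j ha)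

end FiniteCover

end TwistedPartialAction

theorem mainTheorem4 {R : Type u} [Ring R] (hR : HasFiniteUniformDim R)
    (α : TwistedPartialAction R) (hα : α.IsOfFiniteType) :
    α.HasEnvelopingAction := by
  obtain ⟨c⟩ := hα.nonempty_finiteCover
  exact ⟨c.envelope, inferInstance, c.envelopeAction, c.embEnvelope, c.isEnvelopingVia⟩
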